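/- **Setting.** Let $F:\mathbb R^n\to\mathbb R^m$ be continuously differentiable with Jacobian $J$, let $f(x)=\tfrac12\|F(x)\|_2^2$, so $\nabla f(x)=J(x)^TF(x)$, assume $f(x)\ge f_*$ for all $x$, and assume $\|\nabla f(x)-\nabla f(y)\|_2\le L\|x-y\|_2$ for all $x,y$, with $L>0$. **Algorithm (sketched Levenberg–Marquardt step search).** Parameters: $c,\gamma,\widehat\gamma,\eta_{\max}\in(0,1)$, $t_{\max}>0$, $0<\mu_{\min}\le\mu_{\max}$, integers $\ell_{\min}<\ell_{\max}\le n$; initial data $x_0\in\mathbb R^n$, $t_0\in(0,t_{\max}]$, $\ell_0\in[\ell_{\min},\ell_{\max}]$. At iteration $k$, with $\eta_k\in[0,\eta_{\max}]$ and $\mu_k\in[\mu_{\min},\mu_{\max}]$, draw a random matrix $M_k\in\mathbb R^{\ell_k\times n}$ and set $A_k=M_kJ(x_k)^TJ(x_k)M_k^T+\mu_kI$ and $g_k=M_kJ(x_k)^TF(x_k)$. Compute $\widehat s_k\in\mathbb R^{\ell_k}$ with $\|A_k\widehat s_k+g_k\|_2\le\eta_k\|g_k\|_2$ such that either $A_k\widehat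 s_k=-g_k$ or, for some $j\ge0$, $\widehat s_k$ minimizes $$\tfrac12\|J(x_k)M_k^T\widehat s+F(x_k)\|_2^2+\tfrac12\mu_k\|\widehat s\|_2^2$$ over the Krylov subspace $\operatorname{span}\{g_k,A_kg_k,\dots,A_k^{j-1}g_k\}$ (that is, $\widehat s_k$ is an iterate, from the null initial guess, of a Krylov least-squares solver). Let $s_k=M_k^T\widehat s_k$. If $$f(x_k+t_ks_k)<f(x_k)+c\,t_k\,s_k^T\nabla f(x_k),$$ set $x_{k+1}=x_k+t_ks_k$, $t_{k+1}=\min\{t_{\max},\gamma^{-1}t_k\}$, $\ell_{k+1}=\max\{\ell_{\min},\widehat\gamma\ell_k\}$; otherwise set $x_{k+1}=x_k$, $t_{k+1}=\gamma t_k$, $\ell_{k+1}=\min\{\ell_{\max},\widehat\gamma^{-1}\ell_k\}$. Here $\widehat\gamma^{\pm1}\ell_k$ is rounded, up or down, to an integer. Let $X_k,L_k$ be the random variables with realizations $x_k,\ell_k$. **True iterations.** Fix $\varepsilon\in(0,1)$ and $M_{\max}>0$. Iteration $k$ is *true* if $\|M_k\nabla f(x_k)\|_2^2\ge(1-\varepsilon)\|\nabla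 f(x_k)\|_2^2$ and $\|M_k\|_2\le M_{\max}$; let $T_k$ be the event that this holds. Assume that there are $\sigma_\dagger>0$ and $\delta_M\in(0,\tfrac14)$ such that * almost surely, at every true iteration $k$ the largest singular value of $M_kJ(x_k)^TJ(x_k)M_k^T$ is at most $\sigma_\dagger$; * for every $k\ge0$, $\mathbb P(T_k\mid X_k,L_k)\ge1-\delta_M$ almost surely, and $T_k$ is conditionally independent of $T_0,\dots,T_{k-1}$ given $(X_k,L_k)$. **Constants.** For $\tau>0$ let $N_\tau=\inf\{k:\|\nabla f(X_k)\|_2\le\tau\}$ (with $\inf\emptyset=\infty$), and $$h(\tau,t)=c\,t\,\frac{\mu_{\min}(1-\eta_{\max})^2(1-\varepsilon)}{(\sigma_\dagger+\mu_{\max})^2}\,\tau^2,\qquad t_{\rm low}=\frac{2(1-c)\mu_{\min}}{LM_{\max}^2},\qquad \psi_t=\max\left\{1,\left\lceil\log_\gamma\frac{t_{\rm low}}{t_0}\right\rceil\right\}.$$ **Theorem.** Let $\tau>0$, let $\delta_1\in(0,1)$ satisfy $(1-\delta_M)(1-\delta_1)-\tfrac34>0$, and let $N\in\mathbb N$ satisfy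 $$N\ge\left[(1-\delta_M)(1-\delta_1)-\tfrac34\right]^{-1}\left[\frac{f(x_0)-f_*}{h(\tau,t_0\gamma^{1+\psi_t})}+\frac{\psi_t}{2}\right].$$ Then $$\mathbb P(N\ge N_\tau)\ge1-e^{-\frac{\delta_1^2}{2}(1-\delta_M)N}.$$ Since $h(\tau,\cdot)$ is proportional to $\tau^2$, the required number of iterations is of order $\tau^{-2}$. -/

import Mathlib

open MeasureTheory ProbabilityTheory

open scoped InnerProductSpace Gradient

noncomputable section

namespace SketchedLM

/-- `ℝ^d` with the Euclidean norm. -/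
abbrev Euc (d : ℕ) : Type := EuclideanSpace ℝ (Fin d)

/-- An `ℓ × n` sketching matrix, as the linear map `ℝ^n → ℝ^ℓ` it represents. Its adjoint is the
transposed matrix and its operator norm is the spectral norm of the matrix. -/
abbrev Sketch (ℓ n : ℕ) : Type := Euc n →L[ℝ] Euc ℓ

/-! ### The least-squares problem and the sketched Levenberg-Marquardt model -/

section Model

variable {n m ℓ : ℕ}

/-- The nonlinear least-squares objective `f(x) = ½ ‖F(x)‖²`. -/
def objective (F : Euc n → Euc m) (x : Euc n) : ℝ := 1 / 2 * ‖F x‖ ^ 2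

/-- The transposed Jacobian `J(x)ᵀ`, with `J(x)` the derivative of `F` at `x`. -/
def jacT (F : Euc n → Euc m) (x : Euc n) : Euc m →L[ℝ] Euc n :=
  ContinuousLinearMap.adjoint (fderiv ℝ F x)

/-- The transpose `Mᵀ` of a sketching matrix. -/
def sketchT (M : Sketch ℓ n) : Euc ℓ →L[ℝ] Euc n := ContinuousLinearMap.adjoint M

/-- The sketched gradient `M J(x)ᵀ F(x)`. -/
def sketchedGrad (F : Euc n → Euc m) (x : Euc n) (M : Sketch ℓ n) : Euc ℓ :=
  M (jacT F x (F x))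

/-- The sketched Gauss-Newton Hessian `M J(x)ᵀ J(x) Mᵀ`. -/
def sketchedHess (F : Euc n → Euc m) (x : Euc n) (M : Sketch ℓ n) : Euc ℓ →L[ℝ] Euc ℓ :=
  M ∘L jacT F x ∘L fderiv ℝ F x ∘L sketchT M

/-- The regularized sketched Hessian `M J(x)ᵀ J(x) Mᵀ + μ I`. -/
def regHess (F : Euc n → Euc m) (x : Euc n) (M : Sketch ℓ n) (μ : ℝ) : Euc ℓ →L[ℝ] Euc ℓ :=
  sketchedHess F x M + μ • ContinuousLinearMap.id ℝ (Euc ℓ)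

/-- The Levenberg-Marquardt model in the sketched space,
`½ ‖J(x) Mᵀ v + F(x)‖² + ½ μ ‖v‖²`. It is one half of the squared norm of the stacked residual
`[J(x) Mᵀ; √μ I] v + [F(x); 0]`. -/
def lmModel (F : Euc n → Euc m) (x : Euc n) (M : Sketch ℓ n) (μ : ℝ) (v : Euc ℓ) : ℝ :=
  1 / 2 * ‖fderiv ℝ F x (sketchT M v) + F x‖ ^ 2 + 1 / 2 * μ * ‖v‖ ^ 2

/-- The residual `ρ = (M J(x)ᵀ J(x) Mᵀ + μ I) v + M J(x)ᵀ F(x)` of the normal equations. -/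
def normalResidual (F : Euc n → Euc m) (x : Euc n) (M : Sketch ℓ n) (μ : ℝ) (v : Euc ℓ) : Euc ℓ :=
  regHess F x M μ v + sketchedGrad F x M

/-- The `j`-th Krylov subspace `span {g, A g, …, A^(j-1) g}` with `A = M J(x)ᵀ J(x) Mᵀ + μ I` and
`g = M J(x)ᵀ F(x)`. In terms of the stacked matrix `G = [J(x) Mᵀ; √μ I]` and the stacked vector
`[F(x); 0]`, these are `A = Gᵀ G` and `g = Gᵀ [F(x); 0]`. -/
def krylov (F : Euc n → Euc m) (x : Euc n) (M : Sketch ℓ n) (μ : ℝ) (j : ℕ) :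
    Submodule ℝ (Euc ℓ) :=
  Submodule.span ℝ {w | ∃ i : ℕ, i < j ∧ w = (regHess F x M μ ^ i) (sketchedGrad F x M)}

/-- `v` is the `j`-th iterate, started at `0`, of the Krylov least-squares solver applied to the
Levenberg-Marquardt model: it minimizes the norm of the stacked residual (equivalently, the model)
over the `j`-th Krylov subspace. -/
def IsKrylovIterate (F : Euc n → Euc m) (x : Euc n) (M : Sketch ℓ n) (μ : ℝ) (j : ℕ)
    (v : Euc ℓ) : Prop :=
  v ∈ krylov F x M μ j ∧ ∀ w ∈ krylov F x M μ j, lmModel F x M μ v ≤ lmModel F x M μ w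

/-- `v` is an admissible (inexact) Levenberg-Marquardt step in the sketched space with forcing
term `η`: the residual of the normal equations is at most `η ‖M J(x)ᵀ F(x)‖`, and `v` either solves
the normal equations exactly or is an iterate of the Krylov solver. -/
def IsInexactStep (F : Euc n → Euc m) (x : Euc n) (M : Sketch ℓ n) (μ η : ℝ) (v : Euc ℓ) : Prop :=
  ‖normalResidual F x M μ v‖ ≤ η * ‖sketchedGrad F x M‖ ∧
    (normalResidual F x M μ v = 0 ∨ ∃ j : ℕ, IsKrylovIterate F x M μ j v)

/-- The iteration with iterate `x` and sketching matrix `M` is true (with distortion `ε` and norm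
bound `Mmax`): `‖M ∇f(x)‖² ≥ (1 - ε) ‖∇f(x)‖²` and `‖M‖ ≤ Mmax`. -/
def IsTrueIteration (F : Euc n → Euc m) (ε Mmax : ℝ) (x : Euc n) (M : Sketch ℓ n) : Prop :=
  (1 - ε) * ‖∇ (objective F) x‖ ^ 2 ≤ ‖M (∇ (objective F) x)‖ ^ 2 ∧ ‖M‖ ≤ Mmax

/-- The largest singular value of a linear map (Mathlib lists them in decreasing order). -/
def maxSingularValue (A : Euc ℓ →L[ℝ] Euc ℓ) : ℝ :=
  ((A : Euc ℓ →ₗ[ℝ] Euc ℓ).singularValues 0 : ℝ)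

end Model

/-! ### The algorithm -/

/-- The parameters of the algorithm, with their admissible ranges; `n` is the number of variables.
`γℓ` is the factor that changes the sketching size. -/
structure Params (n : ℕ) where
  c : ℝ
  γ : ℝ
  γℓ : ℝ
  tmax : ℝ
  ηmax : ℝ
  μmin : ℝ
  μmax : ℝ
  ℓmin : ℕ
  ℓmax : ℕ
  c_mem : c ∈ Set.Ioo (0 : ℝ) 1
  γ_mem : γ ∈ Set.Ioo (0 : ℝ) 1
  γℓ_mem : γℓ ∈ Set.Ioo (0 : ℝ) 1
  tmax_pos : 0 < tmax
  ηmax_mem : ηmax ∈ Set.Ioo (0 : ℝ) 1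
  μmin_pos : 0 < μmin
  μmin_le : μmin ≤ μmax
  ℓmin_lt : ℓmin < ℓmax
  ℓmax_le : ℓmax ≤ n

/-- `r` is one of the two roundings of `y ≥ 0` to an integer (and `r = y` if `y` is one). -/
def IsRounding (y : ℝ) (r : ℕ) : Prop := r = ⌊y⌋₊ ∨ r = ⌈y⌉₊

section Algorithm

variable {n m : ℕ}

/-- The Armijo acceptance test for the step `s` with steplength `t`. -/
def Armijo (P : Params n) (F : Euc n → Euc m) (x : Euc n) (t : ℝ) (s : Euc n) : Prop :=
  objective F (x + t • s) < objective F x + P.c * t * ⟪s, ∇ (objective F) x⟫_ℝ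

/-- The sequences of iterates `x`, steplengths `t`, sketching sizes `ℓ`, sketching matrices `M`,
forcing terms `η`, regularization parameters `μ` and reduced steps `v` form a realization of the
step-search method started at `x₀, t₀, ℓ₀`. No integer-rounding convention is fixed for the
sketching size, and `M k`, `η k`, `μ k` are chosen freely. -/
structure IsRealization (P : Params n) (F : Euc n → Euc m) (x₀ : Euc n) (t₀ : ℝ) (ℓ₀ : ℕ)
    (x : ℕ → Euc n) (t : ℕ → ℝ) (ℓ : ℕ → ℕ) (M : (k : ℕ) → Sketch (ℓ k) n)
    (η μ : ℕ → ℝ) (v : (k : ℕ) → Euc (ℓ k)) : Prop where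
  x_zero : x 0 = x₀
  t_zero : t 0 = t₀
  ℓ_zero : ℓ 0 = ℓ₀
  η_mem : ∀ k, η k ∈ Set.Icc 0 P.ηmax
  μ_mem : ∀ k, μ k ∈ Set.Icc P.μmin P.μmax
  step : ∀ k, IsInexactStep F (x k) (M k) (μ k) (η k) (v k)
  successful : ∀ k, Armijo P F (x k) (t k) (sketchT (M k) (v k)) →
    x (k + 1) = x k + t k • sketchT (M k) (v k) ∧
    t (k + 1) = min P.tmax (P.γ⁻¹ * t k) ∧
    ∃ r : ℕ, IsRounding (P.γℓ * ℓ k) r ∧ ℓ (k + 1) = max P.ℓmin r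
  unsuccessful : ∀ k, ¬ Armijo P F (x k) (t k) (sketchT (M k) (v k)) →
    x (k + 1) = x k ∧
    t (k + 1) = P.γ * t k ∧
    ∃ r : ℕ, IsRounding (P.γℓ⁻¹ * ℓ k) r ∧ ℓ (k + 1) = min P.ℓmax r

end Algorithm

/-! ### The stochastic process -/

section Stochastic

variable {Ω : Type*} {n m : ℕ}

/-- The event `T_k` that iteration `k` is true. -/
def trueEvent (F : Euc n → Euc m) (ε Mmax : ℝ) (X : ℕ → Ω → Euc n) (L : ℕ → Ω → ℕ)
    (M : (k : ℕ) → (ω : Ω) → Sketch (L k ω) n) (k : ℕ) : Set Ω :=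
  {ω | IsTrueIteration F ε Mmax (X k ω) (M k ω)}

/-- The `σ`-algebra generated by the iterate `X_k` and the sketching size `L_k`. -/
abbrev sigmaXL (X : ℕ → Ω → Euc n) (L : ℕ → Ω → ℕ) (k : ℕ) : MeasurableSpace Ω :=
  MeasurableSpace.comap (fun ω => (X k ω, L k ω)) inferInstance

/-- The `σ`-algebra generated by the events `T 0, …, T (k - 1)`. -/
abbrev sigmaPast (T : ℕ → Set Ω) (k : ℕ) : MeasurableSpace Ω :=
  MeasurableSpace.generateFrom {A | ∃ i : ℕ, i < k ∧ A = T i}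

/-- The event `B` is conditionally independent of the `σ`-algebra `𝒜` given the `σ`-algebra `𝒢`:
`ℙ(B ∩ A | 𝒢) = ℙ(B | 𝒢) ℙ(A | 𝒢)` almost surely for all `A ∈ 𝒜`. -/
def CondIndepEvent [MeasurableSpace Ω] (Pr : Measure Ω) (𝒢 : MeasurableSpace Ω) (B : Set Ω)
    (𝒜 : MeasurableSpace Ω) : Prop :=
  ∀ A : Set Ω, MeasurableSet[𝒜] A → Pr⟦B ∩ A | 𝒢⟧ =ᵐ[Pr] Pr⟦B | 𝒢⟧ * Pr⟦A | 𝒢⟧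

/-- Iterations are true with conditional probability at least `1 - δM`: for every `k`,
`ℙ(T_k | X_k, L_k) ≥ 1 - δM` almost surely, and `T_k` is conditionally independent of
`T_0, …, T_{k-1}` given `X_k` and `L_k`. -/
def TrueInProbability [MeasurableSpace Ω] (Pr : Measure Ω) (F : Euc n → Euc m) (ε Mmax δM : ℝ)
    (X : ℕ → Ω → Euc n) (L : ℕ → Ω → ℕ) (M : (k : ℕ) → (ω : Ω) → Sketch (L k ω) n) : Prop :=
  ∀ k : ℕ,
    (∀ᵐ ω ∂Pr, 1 - δM ≤ (Pr⟦trueEvent F ε Mmax X L M k | sigmaXL X L k⟧) ω) ∧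
    CondIndepEvent Pr (sigmaXL X L k) (trueEvent F ε Mmax X L M k)
      (sigmaPast (trueEvent F ε Mmax X L M) k)

/-- The hitting time `N_τ = inf {k | ‖∇f(X_k)‖ ≤ τ}`, which is `∞` if there is no such `k`. -/
def hittingTime (F : Euc n → Euc m) (τ : ℝ) (X : ℕ → Ω → Euc n) (ω : Ω) : ℕ∞ :=
  ⨅ k : {k : ℕ // ‖∇ (objective F) (X k ω)‖ ≤ τ}, ((k : ℕ) : ℕ∞)

end Stochastic

/-! ### The constants of the complexity bound -/

section Constants

variable {n : ℕ}

/-- The steplength threshold `t_low = 2 (1 - c) μ_min / (L M_max²)`. -/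
def tLow (P : Params n) (Lip Mmax : ℝ) : ℝ := 2 * (1 - P.c) * P.μmin / (Lip * Mmax ^ 2)

/-- `ψ_t = max {1, ⌈log_γ (t_low / t₀)⌉}`. -/
def psi (P : Params n) (Lip Mmax t₀ : ℝ) : ℕ := max 1 ⌈Real.logb P.γ (tLow P Lip Mmax / t₀)⌉₊

/-- `h(τ, t) = c t μ_min (1 - η_max)² (1 - ε) / (σ + μ_max)² τ²`. -/
def hFun (P : Params n) (ε σ τ t : ℝ) : ℝ :=
  P.c * t * (P.μmin * (1 - P.ηmax) ^ 2 * (1 - ε) / (σ + P.μmax) ^ 2) * τ ^ 2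

end Constants

end SketchedLM

end

/-!
If all gradients up to iteration `N` exceed `τ`, the number of true iterations among the first `N`
is bounded deterministically, while a Chernoff bound makes a larger number of them likely.

*Single iterations.* The residual of the normal equations is orthogonal to the reduced step `v`: it
vanishes for an exact solve, and a Krylov iterate minimizes the model along the line `ℝ v`. Hence
`sᵀ∇f = -(‖J Mᵀ v‖² + μ ‖v‖²)` (`IsInexactStep.inner_gradient`), so all successful steps decrease
`f`. At a true iteration `‖v‖` is at least a multiple of `‖∇f‖` (`IsInexactStep.le_sq_norm`), so a
success with steplength `t` decreases `f` by at least `h(τ, t)`; and by the descent lemma a true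
iteration with `t ≤ t_low` is successful (`IsInexactStep.armijo`).

*Counting.* Steplengths move up or down by the factor `γ` and true failures happen only above
`t₀ γ ^ ψ ≤ t_low`, so they are paid for by the `ψ` initial levels and by successes. This yields
`2 #true ≤ N + ψ + 2 #good`, where the good iterations are true and successful with
`t ≥ t₀ γ ^ (1 + ψ)` (`two_mul_count_le_of_steplength`). Each good iteration costs
`h(τ, t₀ γ ^ (1 + ψ))` of the total decrease `f(x₀) - f_*`, whence
`#true ≤ (N + ψ) / 2 + (f(x₀) - f_*) / h` (`IsRealization.count_true_le`).

*Probability.* Conditional independence gives `ℙ(T_k ∩ A) ≥ (1 - δ_M) ℙ(A)` for each `A` in the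
`σ`-algebra of `T_0, …, T_{k-1}`, which suffices for the lower-tail Chernoff bound
`ℙ(#true ≤ (1 - δ_M) (1 - δ₁) N) ≤ exp (-δ₁² (1 - δ_M) N / 2)` (`measureReal_countTrue_le`). On the
complement the hypothesis on `N` contradicts the deterministic bound; it would do so even with
`1 / 2` in place of `3 / 4`.
-/

noncomputable section

namespace SketchedLM

/-! ### Calculus of the least-squares objective -/

section Calculus

variable {n m ℓ : ℕ}

theorem hasGradientAt_objective {F : Euc n → Euc m} (hF : Differentiable ℝ F) (x : Euc n) :
    HasGradientAt (objective F) (jacT F x (F x)) x := by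
  rw [hasGradientAt_iff_hasFDerivAt]
  have h := ((hF x).hasFDerivAt.norm_sq).const_mul (1 / 2 : ℝ)
  refine h.congr_fderiv ?_
  ext d
  simp [jacT, ContinuousLinearMap.adjoint_inner_left]

theorem gradient_objective {F : Euc n → Euc m} (hF : Differentiable ℝ F) (x : Euc n) :
    ∇ (objective F) x = jacT F x (F x) :=
  (hasGradientAt_objective hF x).gradient

/-- The descent lemma for functions with Lipschitz gradient. -/
theorem le_add_inner_add_of_lipschitz_gradient {f : Euc n → ℝ} {g : Euc n → Euc n}
    (hf : ∀ x, HasGradientAt f (g x) x) {K : ℝ} (hg : ∀ x y, ‖g x - g y‖ ≤ K * ‖x - y‖)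
    (x d : Euc n) : f (x + d) ≤ f x + ⟪g x, d⟫_ℝ + K / 2 * ‖d‖ ^ 2 := by
  let φ : ℝ → ℝ := fun r => f (x + r • d) - r * ⟪g x, d⟫_ℝ - K / 2 * ‖d‖ ^ 2 * r ^ 2
  have hφ : ∀ r, HasDerivAt φ (⟪g (x + r • d), d⟫_ℝ - ⟪g x, d⟫_ℝ - K * ‖d‖ ^ 2 * r) r := by
    intro r
    have h1 : HasDerivAt (fun r : ℝ => x + r • d) d r := by
      simpa using ((hasDerivAt_id r).smul_const d).const_add x
    have h2 := (hf (x + r • d)).hasFDerivAt.comp_hasDerivAt r h1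
    have h3 := (h2.sub ((hasDerivAt_id r).mul_const ⟪g x, d⟫_ℝ)).sub
      ((hasDerivAt_pow 2 r).const_mul (K / 2 * ‖d‖ ^ 2))
    refine h3.congr_deriv ?_
    simp
    ring
  have hanti : AntitoneOn φ (Set.Icc 0 1) := by
    refine antitoneOn_of_deriv_nonpos (convex_Icc 0 1)
      (fun r _ => (hφ r).continuousAt.continuousWithinAt)
      (fun r _ => (hφ r).differentiableAt.differentiableWithinAt) fun r hr => ?_
    rw [interior_Icc] at hr
    rw [(hφ r).deriv, ← inner_sub_left]
    have h1 := real_inner_le_norm (g (x + r • d) - g x) d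
    have h2 := hg (x + r • d) x
    rw [add_sub_cancel_left, norm_smul, Real.norm_of_nonneg hr.1.le] at h2
    nlinarith [mul_le_mul_of_nonneg_right h2 (norm_nonneg d)]
  have h := hanti (Set.left_mem_Icc.2 zero_le_one) (Set.right_mem_Icc.2 zero_le_one) zero_le_one
  simp only [φ, one_smul, zero_smul, add_zero] at h
  linarith

end Calculus

/-! ### Inexact Levenberg-Marquardt steps -/

section Steps

variable {n m ℓ : ℕ} {F : Euc n → Euc m} {x : Euc n} {M : Sketch ℓ n}

theorem inner_sketchT (v : Euc ℓ) (w : Euc n) : ⟪sketchT M v, w⟫_ℝ = ⟪v, M w⟫_ℝ :=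
  ContinuousLinearMap.adjoint_inner_left _ _ _

theorem inner_sketchedGrad (v : Euc ℓ) :
    ⟪v, sketchedGrad F x M⟫_ℝ = ⟪fderiv ℝ F x (sketchT M v), F x⟫_ℝ := by
  rw [sketchedGrad, ← inner_sketchT, jacT, ContinuousLinearMap.adjoint_inner_right]

theorem inner_regHess (μ : ℝ) (v : Euc ℓ) :
    ⟪v, regHess F x M μ v⟫_ℝ = ‖fderiv ℝ F x (sketchT M v)‖ ^ 2 + μ * ‖v‖ ^ 2 := by
  simp only [regHess, sketchedHess, add_apply, ContinuousLinearMap.comp_apply, smul_apply,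
    ContinuousLinearMap.id_apply, inner_add_right,
    inner_smul_right, real_inner_self_eq_norm_sq]
  rw [← inner_sketchT, jacT, ContinuousLinearMap.adjoint_inner_right, real_inner_self_eq_norm_sq]

/-- A quadratic `½ S a² + q a` with `S ≥ 0` that is minimal at `a = 1` is stationary there. -/
theorem add_eq_zero_of_quadratic_min {S q : ℝ} (hS : 0 ≤ S)
    (h : ∀ a : ℝ, 1 / 2 * S + q ≤ 1 / 2 * S * a ^ 2 + q * a) : S + q = 0 := by
  -- the point `a` makes the increment `-(S + q)² (S + 2) / (2 (S + 1)²)`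
  have h1 := h (1 - (S + q) / (S + 1))
  have hS1 : S + 1 ≠ 0 := by positivity
  have h2 : 1 / 2 * S * (1 - (S + q) / (S + 1)) ^ 2 + q * (1 - (S + q) / (S + 1))
      = 1 / 2 * S + q - (S + q) ^ 2 * ((S + 2) / (2 * (S + 1) ^ 2)) := by
    field_simp
    ring
  have h3 : 0 < (S + 2) / (2 * (S + 1) ^ 2) := by positivity
  have h4 : (S + q) ^ 2 ≤ 0 := by
    by_contra! h5
    nlinarith [mul_pos h5 h3]
  exact pow_eq_zero_iff two_ne_zero |>.1 (le_antisymm h4 (sq_nonneg _))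

/-- The normal-equation residual of an inexact step is orthogonal to the step: a Krylov iterate
`v` minimizes the model along the line `ℝ v`, which lies in the Krylov subspace. -/
theorem IsInexactStep.inner_sketchedGrad_eq {μ η : ℝ} (hμ : 0 ≤ μ) {v : Euc ℓ}
    (h : IsInexactStep F x M μ η v) :
    ⟪v, sketchedGrad F x M⟫_ℝ = -(‖fderiv ℝ F x (sketchT M v)‖ ^ 2 + μ * ‖v‖ ^ 2) := by
  rcases h.2 with h0 | ⟨j, hv, hmin⟩
  · have h1 : ⟪v, normalResidual F x M μ v⟫_ℝ = 0 := by rw [h0, inner_zero_right]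
    rw [normalResidual, inner_add_right, inner_regHess] at h1
    linarith
  · rw [inner_sketchedGrad]
    have key := add_eq_zero_of_quadratic_min
      (S := ‖fderiv ℝ F x (sketchT M v)‖ ^ 2 + μ * ‖v‖ ^ 2)
      (q := ⟪fderiv ℝ F x (sketchT M v), F x⟫_ℝ) (by positivity) fun a => by
        have h1 := hmin (a • v) (Submodule.smul_mem _ a hv)
        simp only [lmModel, map_smul, norm_add_sq_real, norm_smul, inner_smul_left, mul_pow,
          Real.norm_eq_abs, sq_abs, conj_trivial] at h1
        linarith
    linarith

/-- A linear map is bounded by its largest singular value. -/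
theorem norm_apply_le_maxSingularValue (A : Euc ℓ →L[ℝ] Euc ℓ) (v : Euc ℓ) :
    ‖A v‖ ≤ maxSingularValue A * ‖v‖ := by
  set T : Euc ℓ →ₗ[ℝ] Euc ℓ := (A : Euc ℓ →ₗ[ℝ] Euc ℓ) with hT
  have hs := T.isSymmetric_adjoint_comp_self
  have hn : Module.finrank ℝ (Euc ℓ) = ℓ := by simp
  let b := hs.eigenvectorBasis hn
  have h0 : 0 ≤ maxSingularValue A := T.singularValues_nonneg 0
  refine le_of_sq_le_sq ?_ (by positivity)
  have hcoef : ∀ i, ⟪T.adjoint (T v), b i⟫_ℝ = T.singularValues i ^ 2 * ⟪v, b i⟫_ℝ := by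
    intro i
    have h1 : ⟪T.adjoint (T v), b i⟫_ℝ = ⟪v, (T.adjoint ∘ₗ T) (b i)⟫_ℝ := hs v (b i)
    rw [h1, hs.apply_eigenvectorBasis hn i, inner_smul_right, T.sq_singularValues_fin hn]
    rfl
  calc ‖A v‖ ^ 2 = ⟪T.adjoint (T v), v⟫_ℝ := by
        rw [LinearMap.adjoint_inner_left, real_inner_self_eq_norm_sq]; rfl
    _ = ∑ i : Fin ℓ, T.singularValues i ^ 2 * ⟪v, b i⟫_ℝ ^ 2 := by
        rw [← b.sum_inner_mul_inner]
        refine Finset.sum_congr rfl fun i _ => ?_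
        rw [hcoef, real_inner_comm v (b i)]
        ring
    _ ≤ ∑ i : Fin ℓ, maxSingularValue A ^ 2 * ⟪v, b i⟫_ℝ ^ 2 := by
        refine Finset.sum_le_sum fun i _ => mul_le_mul_of_nonneg_right ?_ (sq_nonneg _)
        exact pow_le_pow_left₀ (T.singularValues_nonneg _)
          (T.singularValues_antitone (Nat.zero_le _)) 2
    _ = (maxSingularValue A * ‖v‖) ^ 2 := by
        rw [← Finset.mul_sum, mul_pow, ← b.sum_sq_norm_inner_left v]
        simp

/-- The inexactness condition forces the step to be at least proportional to the sketched
gradient. -/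
theorem IsInexactStep.le_norm {μ η σ : ℝ} (hμ : 0 ≤ μ) {v : Euc ℓ}
    (h : IsInexactStep F x M μ η v) (hσ : maxSingularValue (sketchedHess F x M) ≤ σ) :
    (1 - η) * ‖sketchedGrad F x M‖ ≤ (σ + μ) * ‖v‖ := by
  have h1 : ‖regHess F x M μ v‖ ≤ (σ + μ) * ‖v‖ := by
    calc ‖regHess F x M μ v‖ = ‖sketchedHess F x M v + μ • v‖ := by simp [regHess]
      _ ≤ ‖sketchedHess F x M v‖ + ‖μ • v‖ := norm_add_le _ _
      _ ≤ σ * ‖v‖ + μ * ‖v‖ := by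
          rw [norm_smul, Real.norm_of_nonneg hμ]
          gcongr
          exact (norm_apply_le_maxSingularValue _ v).trans (by gcongr)
      _ = _ := by ring
  have h2 : ‖sketchedGrad F x M‖ ≤ ‖normalResidual F x M μ v‖ + ‖regHess F x M μ v‖ := by
    have : sketchedGrad F x M = normalResidual F x M μ v - regHess F x M μ v := by
      simp [normalResidual]
    rw [this]
    exact norm_sub_le _ _
  linarith [h.1]

end Steps

/-! ### Counting productive iterations -/

section Counting

open scoped Classical in
/-- The steplength dynamics: increase by `γ⁻¹`, capped at `tmax`, on successful iterations (`S`),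
decrease by `γ` otherwise, with the iterations in `T` successful once `t ≤ t₀ γ ^ ψ`. The number of
iterations in `T` among the first `N` is then controlled by the number of those that are successful
with steplength at least `t₀ γ ^ (1 + ψ)`.

The integer level `w` of `t` is defined by `b γ ^ (1 - w) < t ≤ b γ ^ (-w)` with `b = t₀ γ ^ ψ`.
The absolute value `|w|` drops by one at each success with `w < 0` and at each failure with `0 < w`,
and it grows by at most one otherwise. -/
theorem two_mul_count_le_of_steplength {γ tmax t₀ : ℝ} (hγ : γ ∈ Set.Ioo (0 : ℝ) 1)
    (ht₀ : t₀ ∈ Set.Ioc 0 tmax) {ψ N : ℕ} {t : ℕ → ℝ} {S T : ℕ → Prop} (h0 : t 0 = t₀)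
    (hS : ∀ k, S k → t (k + 1) = min tmax (γ⁻¹ * t k)) (hS' : ∀ k, ¬ S k → t (k + 1) = γ * t k)
    (hT : ∀ k < N, T k → t k ≤ t₀ * γ ^ ψ → S k) :
    2 * Nat.count T N ≤ ψ + N + 2 * Nat.count (fun k => T k ∧ S k ∧ t₀ * γ ^ (1 + ψ) ≤ t k) N := by
  obtain ⟨hγ0, hγ1⟩ := hγ
  obtain ⟨ht0, htm⟩ := ht₀
  have hγne := hγ0.ne'
  set b := t₀ * γ ^ ψ with hb
  have hb0 : 0 < b := by positivity
  have hbm : b ≤ tmax := le_trans (mul_le_of_le_one_right ht0.le (pow_le_one₀ hγ0.le hγ1.le)) htm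
  have hle : ∀ k, t k ≤ tmax ∧ 0 < t k := by
    intro k
    induction k with
    | zero => rw [h0]; exact ⟨htm, ht0⟩
    | succ k ih =>
      by_cases h : S k
      · rw [hS k h]
        exact ⟨min_le_left _ _, lt_min (ht0.trans_le htm) (mul_pos (inv_pos.2 hγ0) ih.2)⟩
      · rw [hS' k h]
        exact ⟨(mul_le_of_le_one_left ih.2.le hγ1.le).trans ih.1, mul_pos hγ0 ih.2⟩
  suffices h : ∀ k ≤ N, ∃ w : ℤ, b * γ ^ (1 - w) < t k ∧ t k ≤ b * γ ^ (-w) ∧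
      |w| + 2 * (Nat.count T k : ℤ) ≤ ψ + k +
        2 * (Nat.count (fun k => T k ∧ S k ∧ t₀ * γ ^ (1 + ψ) ≤ t k) k : ℤ) by
    obtain ⟨w, -, -, hw⟩ := h N le_rfl
    have := abs_nonneg w
    omega
  intro k
  induction k with
  | zero =>
    intro _
    refine ⟨ψ, ?_, ?_, by simp⟩
    · rw [h0, hb, mul_assoc, ← zpow_natCast, ← zpow_add₀ hγne]
      simpa using mul_lt_of_lt_one_right ht0 hγ1
    · rw [h0, hb, mul_assoc, ← zpow_natCast, ← zpow_add₀ hγne]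
      simp
  | succ k ih =>
    intro hk
    obtain ⟨w, hw1, hw2, hw⟩ := ih (by omega)
    have hk' : k < N := by omega
    rw [Nat.count_succ, Nat.count_succ]
    have hanti : ∀ {i j : ℤ}, i ≤ j → b * γ ^ j ≤ b * γ ^ i := fun hij =>
      mul_le_mul_of_nonneg_left (zpow_le_zpow_right_of_le_one₀ hγ0 hγ1.le hij) hb0.le
    have hinv : ∀ i : ℤ, γ⁻¹ * (b * γ ^ i) = b * γ ^ (i - 1) := fun i => by
      rw [zpow_sub_one₀ hγne]; ring
    have hmul : ∀ i : ℤ, γ * (b * γ ^ i) = b * γ ^ (i + 1) := fun i => by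
      rw [zpow_add_one₀ hγne]; ring
    by_cases hs : S k
    · have hlow : γ⁻¹ * (b * γ ^ (1 - w)) < γ⁻¹ * t k := by gcongr
      have hup : γ⁻¹ * t k ≤ γ⁻¹ * (b * γ ^ (-w)) := by gcongr
      rw [hinv] at hlow hup
      by_cases hw0 : w < 0
      · -- below level `0` the cap `tmax` is inactive
        have hcap : γ⁻¹ * t k ≤ tmax := by
          refine hup.trans (le_trans ?_ hbm)
          simpa using hanti (show (0 : ℤ) ≤ -w - 1 by omega)
        refine ⟨w + 1, ?_, ?_, ?_⟩
        · rw [hS k hs, min_eq_right hcap]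
          rwa [show 1 - (w + 1) = 1 - w - 1 by ring]
        · rw [hS k hs, min_eq_right hcap]
          rwa [show -(w + 1) = -w - 1 by ring]
        · rw [abs_of_neg hw0] at hw
          rw [abs_of_nonpos (by omega)]
          by_cases hTk : T k
          · rw [if_pos hTk]
            push_cast; omega
          · rw [if_neg hTk, if_neg (fun h : T k ∧ S k ∧ _ => hTk h.1)]
            push_cast; omega
      · have hgood : t₀ * γ ^ (1 + ψ) ≤ t k := by
          have h1 := hanti (show 1 - w ≤ 1 by omega)
          rw [zpow_one, hb] at h1
          refine le_trans (le_of_eq ?_) (h1.trans hw1.le)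
          ring
        have hge : t k ≤ t (k + 1) := by
          rw [hS k hs]
          exact le_min (hle k).1
            (le_mul_of_one_le_left (hle k).2.le ((one_le_inv₀ hγ0).2 hγ1.le))
        rw [abs_of_nonneg (by omega)] at hw
        have hcount : ((if T k then 1 else 0 : ℕ) : ℤ) =
            (if T k ∧ S k ∧ t₀ * γ ^ (1 + ψ) ≤ t k then 1 else 0 : ℕ) := by
          simp only [hs, hgood, and_true]
        push_cast at hcount ⊢
        by_cases hcap : t (k + 1) ≤ b * γ ^ (-w)
        · refine ⟨w, hw1.trans_le hge, hcap, ?_⟩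
          rw [abs_of_nonneg (by omega)]
          split_ifs at hcount ⊢ <;> omega
        · refine ⟨w + 1, ?_, ?_, ?_⟩
          · rw [show 1 - (w + 1) = -w by ring]
            exact not_le.1 hcap
          · rw [hS k hs]
            refine (min_le_right _ _).trans ?_
            rwa [show -(w + 1) = -w - 1 by ring]
          · rw [abs_of_nonneg (by omega)]
            split_ifs at hcount ⊢ <;> omega
    · have hlow : γ * (b * γ ^ (1 - w)) < γ * t k := by gcongr
      have hup : γ * t k ≤ γ * (b * γ ^ (-w)) := by gcongr
      rw [hmul] at hlow hup
      refine ⟨w - 1, ?_, ?_, ?_⟩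
      · rw [hS' k hs]; rwa [show 1 - (w - 1) = 1 - w + 1 by ring]
      · rw [hS' k hs]; rwa [show -(w - 1) = -w + 1 by ring]
      · rw [if_neg (fun h : T k ∧ S k ∧ _ => hs h.2.1)]
        by_cases hTk : T k
        · -- failures in `T` occur only above level `0`
          have hw0 : 0 < w := by
            by_contra! hw0
            refine hs (hT k hk' hTk (hw2.trans ?_))
            simpa using hanti (show (0 : ℤ) ≤ -w by omega)
          rw [if_pos hTk]
          rw [abs_of_pos hw0] at hw
          rw [abs_of_nonneg (by omega)]
          push_cast; omega
        · rw [if_neg hTk]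
          have := abs_sub w 1
          rw [abs_one] at this
          push_cast; omega

end Counting

/-! ### A Chernoff bound for conditionally likely events -/

section Chernoff

variable {Ω : Type*}

/-- Conditional independence given `𝒢` and a conditional lower bound `p` combine, after
integration, to `ℙ(B ∩ A) ≥ p ℙ(A)`. -/
theorem mul_measureReal_le_of_condIndepEvent {𝒢 𝒜 m0 : MeasurableSpace Ω}
    {Pr : Measure Ω} [IsProbabilityMeasure Pr] (h𝒢 : 𝒢 ≤ m0)
    (h𝒜 : 𝒜 ≤ m0) {B : Set Ω} (hB : MeasurableSet B) {p : ℝ}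
    (hp : ∀ᵐ ω ∂Pr, p ≤ (Pr⟦B | 𝒢⟧) ω) (hind : CondIndepEvent Pr 𝒢 B 𝒜) {A : Set Ω}
    (hA : MeasurableSet[𝒜] A) : p * Pr.real A ≤ Pr.real (B ∩ A) := by
  have hint : ∀ C : Set Ω, MeasurableSet C → ∫ ω, (Pr⟦C | 𝒢⟧) ω ∂Pr = Pr.real C := fun C hC => by
    rw [integral_condExp h𝒢]
    simp [integral_indicator hC]
  have hA' := h𝒜 A hA
  rw [← hint A hA', ← hint _ (hB.inter hA'), ← integral_const_mul]
  refine integral_mono_ae (integrable_condExp.const_mul p) integrable_condExp ?_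
  have hnn : 0 ≤ᵐ[Pr] Pr⟦A | 𝒢⟧ :=
    condExp_nonneg (ae_of_all _ fun ω => Set.indicator_nonneg (fun _ _ => zero_le_one) ω)
  filter_upwards [hp, hind A hA, hnn] with ω h1 h2 h3
  rw [h2]
  exact mul_le_mul_of_nonneg_right h1 h3

open scoped Classical in
/-- The number of the events `T 0, …, T (k - 1)` that occur. -/
def countTrue (T : ℕ → Set Ω) (k : ℕ) (ω : Ω) : ℕ := Nat.count (ω ∈ T ·) k

theorem countTrue_succ (T : ℕ → Set Ω) (k : ℕ) (ω : Ω) :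
    countTrue T (k + 1) ω = countTrue T k ω + (T k).indicator 1 ω := by
  classical
  rw [countTrue, countTrue, Nat.count_succ, Set.indicator_apply, Pi.one_apply]

theorem measurable_countTrue {𝒜 : MeasurableSpace Ω} {T : ℕ → Set Ω} {k : ℕ}
    (hT : ∀ i < k, MeasurableSet[𝒜] (T i)) : Measurable[𝒜] (countTrue T k) := by
  induction k with
  | zero => exact measurable_const
  | succ k ih =>
    have h : countTrue T (k + 1) = fun ω => countTrue T k ω + (T k).indicator 1 ω :=
      funext (countTrue_succ T k)
    rw [h]
    exact (ih fun i hi => hT i (by omega)).add (measurable_one.indicator (hT k (by omega)))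

theorem countTrue_le (T : ℕ → Set Ω) (k : ℕ) (ω : Ω) : countTrue T k ω ≤ k := by
  classical
  exact Nat.count_le _

variable [MeasurableSpace Ω] {Pr : Measure Ω} [IsProbabilityMeasure Pr]

theorem integrable_comp_countTrue {T : ℕ → Set Ω} (hT : ∀ k, MeasurableSet (T k)) (k : ℕ)
    (f : ℕ → ℝ) : Integrable (fun ω => f (countTrue T k ω)) Pr := by
  have hm : Measurable fun ω => f (countTrue T k ω) :=
    measurable_from_nat.comp (measurable_countTrue fun i _ => hT i)
  refine Integrable.of_bound (C := ∑ i ∈ Finset.range (k + 1), ‖f i‖) hm.aestronglyMeasurable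
    (ae_of_all _ fun ω => ?_)
  exact Finset.single_le_sum (f := fun i => ‖f i‖) (fun i _ => norm_nonneg _)
    (Finset.mem_range.2 (Nat.lt_succ_of_le (countTrue_le T k ω)))

/-- If each `T k` has probability at least `p` on every event of the past, then it has weight at
least `p` against every nonnegative function of the past count. -/
theorem mul_integral_le_setIntegral_countTrue {T : ℕ → Set Ω} (hT : ∀ k, MeasurableSet (T k))
    {p : ℝ} (h : ∀ k A, MeasurableSet[sigmaPast T k] A → p * Pr.real A ≤ Pr.real (T k ∩ A))
    (k : ℕ) {f : ℕ → ℝ} (hf : ∀ i, 0 ≤ f i) :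
    p * ∫ ω, f (countTrue T k ω) ∂Pr ≤ ∫ ω in T k, f (countTrue T k ω) ∂Pr := by
  have hpast : Measurable[sigmaPast T k] (countTrue T k) :=
    measurable_countTrue fun i hi => MeasurableSpace.measurableSet_generateFrom ⟨i, hi, rfl⟩
  have hm : Measurable (countTrue T k) := measurable_countTrue fun i _ => hT i
  have hsum : ∀ ω, f (countTrue T k ω) = ∑ i ∈ Finset.range (k + 1),
      (countTrue T k ⁻¹' {i}).indicator (fun _ => f i) ω := by
    intro ω
    rw [Finset.sum_eq_single (countTrue T k ω)]
    · simp
    · intro i _ hi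
      exact Set.indicator_of_notMem (fun h' => hi (by simpa using h'.symm)) _
    · intro h'
      exact absurd (Finset.mem_range.2 (Nat.lt_succ_of_le (countTrue_le T k ω))) h'
  have hms : ∀ i, MeasurableSet (countTrue T k ⁻¹' {i}) := fun i => hm (measurableSet_singleton i)
  simp_rw [hsum]
  rw [integral_finsetSum _ fun i _ => (integrable_const (f i)).indicator (hms i),
    integral_finsetSum _ fun i _ => ((integrable_const (f i)).indicator (hms i)).integrableOn,
    Finset.mul_sum]
  refine Finset.sum_le_sum fun i _ => ?_
  rw [integral_indicator_const _ (hms i), integral_indicator_const _ (hms i), smul_eq_mul,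
    smul_eq_mul, ← mul_assoc, measureReal_restrict_apply (hms i), Set.inter_comm]
  exact mul_le_mul_of_nonneg_right (h k _ (hpast (measurableSet_singleton i))) (hf i)

theorem integral_exp_neg_countTrue_le {T : ℕ → Set Ω} (hT : ∀ k, MeasurableSet (T k))
    {p : ℝ} (h : ∀ k A, MeasurableSet[sigmaPast T k] A → p * Pr.real A ≤ Pr.real (T k ∩ A))
    {s : ℝ} (hs : 0 ≤ s) (k : ℕ) :
    ∫ ω, Real.exp (-s * countTrue T k ω) ∂Pr ≤ Real.exp (-p * (1 - Real.exp (-s)) * k) := by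
  induction k with
  | zero => simp [countTrue]
  | succ k ih =>
    have hI := integrable_comp_countTrue (Pr := Pr) hT k fun i => Real.exp (-s * i)
    have hstep : ∀ ω, Real.exp (-s * countTrue T (k + 1) ω) = Real.exp (-s * countTrue T k ω) -
        (1 - Real.exp (-s)) * (T k).indicator (fun ω => Real.exp (-s * countTrue T k ω)) ω := by
      intro ω
      rw [countTrue_succ]
      by_cases hω : ω ∈ T k
      · simp only [hω, Set.indicator_of_mem, Pi.one_apply]
        push_cast
        rw [mul_add, mul_one, Real.exp_add]
        ring
      · simp [hω]
    have hs1 : 0 ≤ 1 - Real.exp (-s) := by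
      rw [sub_nonneg, Real.exp_le_one_iff]; linarith
    have hk := mul_integral_le_setIntegral_countTrue hT h k
      (f := fun i => Real.exp (-s * i)) fun i => (Real.exp_pos _).le
    simp_rw [hstep]
    rw [integral_sub hI ((hI.indicator (hT k)).const_mul _), integral_const_mul,
      integral_indicator (hT k)]
    have hnn : 0 ≤ ∫ ω, Real.exp (-s * countTrue T k ω) ∂Pr :=
      integral_nonneg fun ω => (Real.exp_pos _).le
    calc _ ≤ (∫ ω, Real.exp (-s * countTrue T k ω) ∂Pr) * (-p * (1 - Real.exp (-s)) + 1) := by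
          nlinarith [mul_le_mul_of_nonneg_left hk hs1]
      _ ≤ (∫ ω, Real.exp (-s * countTrue T k ω) ∂Pr) * Real.exp (-p * (1 - Real.exp (-s))) :=
          mul_le_mul_of_nonneg_left (Real.add_one_le_exp _) hnn
      _ ≤ Real.exp (-p * (1 - Real.exp (-s)) * k) * Real.exp (-p * (1 - Real.exp (-s))) :=
          mul_le_mul_of_nonneg_right ih (Real.exp_pos _).le
      _ = _ := by
          rw [← Real.exp_add]
          push_cast
          ring_nf

theorem exp_neg_le_quadratic {s : ℝ} (hs : 0 ≤ s) : Real.exp (-s) ≤ 1 - s + s ^ 2 / 2 := by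
  have h1 := Real.quadratic_le_exp_of_nonneg hs
  rw [Real.exp_neg]
  refine inv_le_of_inv_le₀ (by nlinarith [sq_nonneg (s - 1)]) ?_
  refine le_trans ?_ h1
  refine inv_le_of_inv_le₀ (by positivity) ?_
  rw [inv_le_iff_one_le_mul₀ (by positivity)]
  -- `(1 + s + s² / 2) (1 - s + s² / 2) = 1 + s⁴ / 4`
  nlinarith [sq_nonneg (s ^ 2)]

/-- The lower tail of the multiplicative Chernoff bound, with the exponential parameter `δ`. -/
theorem measureReal_countTrue_le {T : ℕ → Set Ω} (hT : ∀ k, MeasurableSet (T k))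
    {p : ℝ} (hp : 0 ≤ p)
    (h : ∀ k A, MeasurableSet[sigmaPast T k] A → p * Pr.real A ≤ Pr.real (T k ∩ A))
    {δ : ℝ} (hδ : 0 ≤ δ) (N : ℕ) :
    Pr.real {ω | (countTrue T N ω : ℝ) ≤ p * (1 - δ) * N} ≤ Real.exp (-(δ ^ 2 / 2) * p * N) := by
  have hI : Integrable (fun ω => Real.exp (-δ * (countTrue T N ω : ℝ))) Pr :=
    integrable_comp_countTrue hT N fun i => Real.exp (-δ * i)
  refine (measure_le_le_exp_mul_mgf (X := fun ω => (countTrue T N ω : ℝ)) _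
    (neg_nonpos.2 hδ) hI).trans ?_
  have h1 := integral_exp_neg_countTrue_le hT h hδ N
  calc _ ≤ Real.exp (-(-δ) * (p * (1 - δ) * N)) * Real.exp (-p * (1 - Real.exp (-δ)) * N) :=
        mul_le_mul_of_nonneg_left h1 (Real.exp_pos _).le
    _ = Real.exp (p * N * (Real.exp (-δ) - 1 + δ - δ ^ 2)) := by
        rw [← Real.exp_add]; ring_nf
    _ ≤ _ := by
        refine Real.exp_le_exp.2 ?_
        have hpN : 0 ≤ p * N := by positivity
        nlinarith [mul_le_mul_of_nonneg_left (exp_neg_le_quadratic hδ) hpN]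

end Chernoff

/-! ### True iterations -/

section TrueIterations

variable {n m ℓ : ℕ} {F : Euc n → Euc m} {x : Euc n} {M : Sketch ℓ n}

theorem IsInexactStep.inner_gradient (hF : Differentiable ℝ F) {μ η : ℝ} (hμ : 0 ≤ μ) {v : Euc ℓ}
    (h : IsInexactStep F x M μ η v) : ⟪sketchT M v, ∇ (objective F) x⟫_ℝ =
      -(‖fderiv ℝ F x (sketchT M v)‖ ^ 2 + μ * ‖v‖ ^ 2) := by
  rw [inner_sketchT, gradient_objective hF, ← h.inner_sketchedGrad_eq hμ, sketchedGrad]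

/-- At a true iteration a nonzero step passes the Armijo test once `t ≤ t_low`. The test is strict
even at `t = t_low`, because `J Mᵀ v = 0` would make `v` vanish. -/
theorem IsInexactStep.armijo (hF : Differentiable ℝ F) {Lip : ℝ} (hLip : 0 < Lip)
    (hgrad : ∀ x y, ‖∇ (objective F) x - ∇ (objective F) y‖ ≤ Lip * ‖x - y‖) {P : Params n}
    {μ η : ℝ} (hμ : P.μmin ≤ μ) {v : Euc ℓ} (h : IsInexactStep F x M μ η v) (hv : v ≠ 0)
    {Mmax : ℝ} (hMmax : 0 < Mmax) (hM : ‖M‖ ≤ Mmax) {t : ℝ} (ht : 0 < t)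
    (htl : t ≤ tLow P Lip Mmax) : Armijo P F x t (sketchT M v) := by
  have hμ0 : 0 < μ := P.μmin_pos.trans_le hμ
  have hv0 : 0 < ‖v‖ ^ 2 := by positivity
  have hin := h.inner_gradient hF hμ0.le
  have hJ : 0 < ‖fderiv ℝ F x (sketchT M v)‖ ^ 2 := by
    have h0 : fderiv ℝ F x (sketchT M v) ≠ 0 := fun h0 => by
      have h1 := h.inner_sketchedGrad_eq hμ0.le
      rw [inner_sketchedGrad, h0] at h1
      simp only [inner_zero_left, norm_zero] at h1
      nlinarith [mul_pos hμ0 hv0]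
    positivity
  have hs : ‖sketchT M v‖ ^ 2 ≤ Mmax ^ 2 * ‖v‖ ^ 2 := by
    rw [← mul_pow]
    refine pow_le_pow_left₀ (norm_nonneg _) ?_ 2
    refine ((sketchT M).le_opNorm v).trans (mul_le_mul_of_nonneg_right ?_ (norm_nonneg _))
    rwa [sketchT, LinearIsometryEquiv.norm_map]
  have hd := le_add_inner_add_of_lipschitz_gradient
    (fun y => (hasGradientAt_objective hF y).differentiableAt.hasGradientAt) hgrad x
    (t • sketchT M v)
  rw [inner_smul_right, real_inner_comm, norm_smul, mul_pow, Real.norm_of_nonneg ht.le] at hd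
  rw [tLow, le_div_iff₀ (by positivity)] at htl
  have hc : 0 < 1 - P.c := sub_pos.2 P.c_mem.2
  rw [Armijo]
  set Q := ‖fderiv ℝ F x (sketchT M v)‖ ^ 2
  have h1 : Lip / 2 * (t ^ 2 * ‖sketchT M v‖ ^ 2) ≤ t * ((1 - P.c) * (μ * ‖v‖ ^ 2)) := by
    calc Lip / 2 * (t ^ 2 * ‖sketchT M v‖ ^ 2)
        ≤ Lip / 2 * (t ^ 2 * (Mmax ^ 2 * ‖v‖ ^ 2)) := by gcongr
      _ = t * ‖v‖ ^ 2 / 2 * (t * (Lip * Mmax ^ 2)) := by ring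
      _ ≤ t * ‖v‖ ^ 2 / 2 * (2 * (1 - P.c) * P.μmin) := by gcongr
      _ = t * ((1 - P.c) * (P.μmin * ‖v‖ ^ 2)) := by ring
      _ ≤ _ := by gcongr
  have h2 : 0 < t * ((1 - P.c) * Q) := by positivity
  rw [hin] at hd ⊢
  linarith

/-- At a true iteration the step size is bounded below by a multiple of the gradient norm. -/
theorem IsInexactStep.le_sq_norm {P : Params n} (hF : Differentiable ℝ F) {ε Mmax : ℝ}
    (hε : ε < 1) (hT : IsTrueIteration F ε Mmax x M) {μ η : ℝ} (hμ : μ ∈ Set.Icc P.μmin P.μmax)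
    (hη : η ∈ Set.Icc 0 P.ηmax) {v : Euc ℓ} (h : IsInexactStep F x M μ η v) {σ : ℝ} (hσ0 : 0 < σ)
    (hσ : maxSingularValue (sketchedHess F x M) ≤ σ) {τ : ℝ} (hτ : 0 < τ)
    (hx : τ ≤ ‖∇ (objective F) x‖) :
    (1 - P.ηmax) ^ 2 * (1 - ε) / (σ + P.μmax) ^ 2 * τ ^ 2 ≤ ‖v‖ ^ 2 := by
  have hμ0 : 0 < μ := P.μmin_pos.trans_le hμ.1
  have hμmax : 0 < P.μmax := hμ0.trans_le hμ.2
  have h1 := h.le_norm hμ0.le hσ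
  have h2 : (1 - P.ηmax) * ‖sketchedGrad F x M‖ ≤ (σ + P.μmax) * ‖v‖ :=
    calc _ ≤ (1 - η) * ‖sketchedGrad F x M‖ := by gcongr; exact hη.2
      _ ≤ _ := h1
      _ ≤ _ := by gcongr; exact hμ.2
  have h3 : (1 - P.ηmax) ^ 2 * ‖sketchedGrad F x M‖ ^ 2 ≤ (σ + P.μmax) ^ 2 * ‖v‖ ^ 2 := by
    rw [← mul_pow, ← mul_pow]
    exact pow_le_pow_left₀ (mul_nonneg (sub_nonneg.2 P.ηmax_mem.2.le) (norm_nonneg _)) h2 2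
  have h4 : (1 - ε) * τ ^ 2 ≤ ‖sketchedGrad F x M‖ ^ 2 := by
    rw [sketchedGrad, ← gradient_objective hF]
    refine le_trans ?_ hT.1
    have := sub_pos.2 hε
    gcongr
  rw [div_mul_eq_mul_div, div_le_iff₀ (by positivity), mul_assoc, mul_comm (‖v‖ ^ 2)]
  exact (mul_le_mul_of_nonneg_left h4 (sq_nonneg _)).trans h3

end TrueIterations

/-! ### Realizations that stay away from stationarity -/

section Realizations

variable {n m : ℕ} {F : Euc n → Euc m}

theorem hFun_pos {P : Params n} {ε σ τ t : ℝ} (hε : ε < 1) (hσ : 0 < σ) (hτ : 0 < τ) (ht : 0 < t) :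
    0 < hFun P ε σ τ t := by
  have h1 := P.c_mem.1
  have h2 := P.μmin_pos
  have h3 := P.μmin_pos.trans_le P.μmin_le
  have h4 := sub_pos.2 P.ηmax_mem.2
  have h5 := sub_pos.2 hε
  rw [hFun]
  positivity

theorem tLow_pos {P : Params n} {Lip Mmax : ℝ} (hLip : 0 < Lip) (hMmax : 0 < Mmax) :
    0 < tLow P Lip Mmax := by
  have h2 := P.μmin_pos
  have h5 := sub_pos.2 P.c_mem.2
  rw [tLow]
  positivity

theorem mul_pow_psi_le_tLow {P : Params n} {Lip Mmax t₀ : ℝ} (hLip : 0 < Lip) (hMmax : 0 < Mmax)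
    (ht₀ : 0 < t₀) : t₀ * P.γ ^ psi P Lip Mmax t₀ ≤ tLow P Lip Mmax := by
  have hl := tLow_pos (P := P) hLip hMmax
  obtain ⟨hγ0, hγ1⟩ := P.γ_mem
  have h1 : Real.logb P.γ (tLow P Lip Mmax / t₀) ≤ psi P Lip Mmax t₀ :=
    (Nat.le_ceil _).trans (by exact_mod_cast le_max_right _ _)
  have h2 := Real.rpow_le_rpow_of_exponent_ge hγ0 hγ1.le h1
  rw [Real.rpow_logb hγ0 hγ1.ne (by positivity), Real.rpow_natCast, le_div_iff₀ ht₀] at h2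
  linarith

open scoped Classical in
/-- A realization whose first `N` gradients exceed `τ` has at most `(N + ψ) / 2` true iterations
besides those that decrease the objective by `h(τ, t₀ γ ^ (1 + ψ))`, and the latter are limited by
the lower bound of the objective. -/
theorem IsRealization.count_true_le (hF : Differentiable ℝ F) {fstar : ℝ}
    (hfstar : ∀ x, fstar ≤ objective F x) {Lip : ℝ} (hLip : 0 < Lip)
    (hgrad : ∀ x y, ‖∇ (objective F) x - ∇ (objective F) y‖ ≤ Lip * ‖x - y‖) {P : Params n}
    {x₀ : Euc n} {t₀ : ℝ} (ht₀ : t₀ ∈ Set.Ioc 0 P.tmax) {ℓ₀ : ℕ} {x : ℕ → Euc n} {t : ℕ → ℝ}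
    {ℓ : ℕ → ℕ} {M : (k : ℕ) → Sketch (ℓ k) n} {η μ : ℕ → ℝ} {v : (k : ℕ) → Euc (ℓ k)}
    (h : IsRealization P F x₀ t₀ ℓ₀ x t ℓ M η μ v) {ε Mmax σ τ : ℝ} (hε : ε < 1)
    (hMmax : 0 < Mmax) (hσ0 : 0 < σ)
    (hσ : ∀ k, IsTrueIteration F ε Mmax (x k) (M k) →
      maxSingularValue (sketchedHess F (x k) (M k)) ≤ σ) (hτ : 0 < τ) {N : ℕ}
    (hN : ∀ k < N, τ ≤ ‖∇ (objective F) (x k)‖) :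
    (Nat.count (fun k => IsTrueIteration F ε Mmax (x k) (M k)) N : ℝ) ≤
      (N + psi P Lip Mmax t₀) / 2 +
        (objective F x₀ - fstar) / hFun P ε σ τ (t₀ * P.γ ^ (1 + psi P Lip Mmax t₀)) := by
  set ψ := psi P Lip Mmax t₀ with hψ
  obtain ⟨hγ0, hγ1⟩ := P.γ_mem
  have hh : 0 < hFun P ε σ τ (t₀ * P.γ ^ (1 + ψ)) :=
    hFun_pos hε hσ0 hτ (mul_pos ht₀.1 (pow_pos hγ0 _))
  set H := hFun P ε σ τ (t₀ * P.γ ^ (1 + ψ)) with hH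
  have hstepsize := fun k (hk : k < N) (hT : IsTrueIteration F ε Mmax (x k) (M k)) =>
    (h.step k).le_sq_norm hF hε hT (h.μ_mem k) (h.η_mem k) hσ0 (hσ k hT) hτ (hN k hk)
  have hμ0 : ∀ k, 0 < μ k := fun k => P.μmin_pos.trans_le (h.μ_mem k).1
  have htpos : ∀ k, 0 < t k := by
    intro k
    induction k with
    | zero => rw [h.t_zero]; exact ht₀.1
    | succ k ih =>
      by_cases hs : Armijo P F (x k) (t k) (sketchT (M k) (v k))
      · rw [(h.successful k hs).2.1]
        exact lt_min P.tmax_pos (mul_pos (inv_pos.2 hγ0) ih)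
      · rw [(h.unsuccessful k hs).2.1]
        exact mul_pos hγ0 ih
  have hcount := two_mul_count_le_of_steplength (ψ := ψ) (N := N)
    (S := fun k => Armijo P F (x k) (t k) (sketchT (M k) (v k)))
    (T := fun k => IsTrueIteration F ε Mmax (x k) (M k)) P.γ_mem ht₀ h.t_zero
    (fun k hs => (h.successful k hs).2.1) (fun k hs => (h.unsuccessful k hs).2.1)
    fun k hk hT htk => by
      refine (h.step k).armijo hF hLip hgrad (h.μ_mem k).1 (fun hv => ?_) hMmax hT.2 (htpos k)
        (htk.trans (mul_pow_psi_le_tLow hLip hMmax ht₀.1))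
      have h1 := hstepsize k hk hT
      have h2 := sub_pos.2 P.ηmax_mem.2
      have h3 := sub_pos.2 hε
      have h4 := P.μmin_pos.trans_le P.μmin_le
      rw [hv, norm_zero, zero_pow two_ne_zero] at h1
      exact absurd h1 (not_le.2 (by positivity))
  have hdec : ∀ k ≤ N, objective F (x k) + H * Nat.count (fun k =>
      IsTrueIteration F ε Mmax (x k) (M k) ∧ Armijo P F (x k) (t k) (sketchT (M k) (v k)) ∧
        t₀ * P.γ ^ (1 + ψ) ≤ t k) k ≤ objective F x₀ := by
    intro k
    induction k with
    | zero => intro _; simp [h.x_zero]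
    | succ k ih =>
      intro hk
      have ih := ih (by omega)
      rw [Nat.count_succ]
      by_cases hs : Armijo P F (x k) (t k) (sketchT (M k) (v k))
      · rw [(h.successful k hs).1]
        have ha := hs
        rw [Armijo, (h.step k).inner_gradient hF (hμ0 k).le] at ha
        have hc := mul_pos P.c_mem.1 (htpos k)
        split_ifs with hg
        · have hQ : H ≤ P.c * t k * (μ k * ‖v k‖ ^ 2) := by
            have h0 := hμ0 k
            calc H = P.c * (t₀ * P.γ ^ (1 + ψ)) * (P.μmin *
                  ((1 - P.ηmax) ^ 2 * (1 - ε) / (σ + P.μmax) ^ 2 * τ ^ 2)) := by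
                  rw [hH, hFun]; ring
              _ ≤ P.c * (t₀ * P.γ ^ (1 + ψ)) * (μ k * ‖v k‖ ^ 2) := by
                  have h1 := P.c_mem.1
                  have h2 := ht₀.1
                  refine mul_le_mul_of_nonneg_left ?_ (by positivity)
                  exact (mul_le_mul_of_nonneg_left (hstepsize k (by omega) hg.1)
                    P.μmin_pos.le).trans
                    (mul_le_mul_of_nonneg_right (h.μ_mem k).1 (sq_nonneg _))
              _ ≤ _ := mul_le_mul_of_nonneg_right
                  (mul_le_mul_of_nonneg_left hg.2.2 P.c_mem.1.le) (by positivity)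
          push_cast
          nlinarith [mul_nonneg hc.le (sq_nonneg ‖fderiv ℝ F (x k) (sketchT (M k) (v k))‖)]
        · have h0 : 0 ≤ ‖fderiv ℝ F (x k) (sketchT (M k) (v k))‖ ^ 2 + μ k * ‖v k‖ ^ 2 := by
            have := hμ0 k
            positivity
          have := mul_nonneg hc.le h0
          rw [add_zero]
          linarith
      · rw [if_neg (fun hg : _ ∧ _ ∧ _ => hs hg.2.1), (h.unsuccessful k hs).1, add_zero]
        exact ih
  have hG := hdec N le_rfl
  have hG' := le_trans (add_le_add_left (hfstar (x N)) _) hG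
  have hc' : (2 : ℝ) * Nat.count (fun k => IsTrueIteration F ε Mmax (x k) (M k)) N ≤ ψ + N +
      2 * Nat.count (fun k => IsTrueIteration F ε Mmax (x k) (M k) ∧
        Armijo P F (x k) (t k) (sketchT (M k) (v k)) ∧ t₀ * P.γ ^ (1 + ψ) ≤ t k) N := by
    exact_mod_cast hcount
  have hdiv : (Nat.count (fun k => IsTrueIteration F ε Mmax (x k) (M k) ∧
      Armijo P F (x k) (t k) (sketchT (M k) (v k)) ∧ t₀ * P.γ ^ (1 + ψ) ≤ t k) N : ℝ) ≤
      (objective F x₀ - fstar) / H := by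
    rw [le_div_iff₀ hh]
    linarith
  linarith

end Realizations

/-! ### Measurability of the true events -/

section Measurability

variable {Ω : Type*} [MeasurableSpace Ω] {n m : ℕ}

theorem measurable_of_comp_sigmaMk {ι β : Type*} {α : ι → Type*} [∀ i, MeasurableSpace (α i)]
    [MeasurableSpace β] {f : (Σ i, α i) → β} (h : ∀ i, Measurable fun a => f ⟨i, a⟩) :
    Measurable f := by
  intro s hs
  rw [MeasurableSpace.measurableSet_iInf]
  exact fun i => h i hs

theorem measurable_norm_sketch_apply {L : Ω → ℕ} {M : (ω : Ω) → Sketch (L ω) n} {Y : Ω → Euc n}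
    (hM : Measurable fun ω => (⟨L ω, M ω⟩ : Σ ℓ : ℕ, Sketch ℓ n)) (hY : Measurable Y) :
    Measurable fun ω => ‖M ω (Y ω)‖ := by
  have h1 : Measurable (Function.uncurry fun (y : Euc n) (s : Σ ℓ : ℕ, Sketch ℓ n) => ‖s.2 y‖) := by
    refine measurable_uncurry_of_continuous_of_measurable (fun s => s.2.continuous.norm) fun y => ?_
    refine measurable_of_comp_sigmaMk fun ℓ => ?_
    have h : Continuous fun s : Sketch ℓ n => ‖s y‖ := by fun_prop
    exact h.measurable
  have h2 := h1.comp (hY.prodMk hM)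
  -- reducing the projections first keeps the unifier from unfolding the norms of `Sketch`
  simp only [Function.comp_def, Function.uncurry_apply_pair] at h2
  exact h2

theorem measurable_norm_sketch {L : Ω → ℕ} {M : (ω : Ω) → Sketch (L ω) n}
    (hM : Measurable fun ω => (⟨L ω, M ω⟩ : Σ ℓ : ℕ, Sketch ℓ n)) :
    Measurable fun ω => ‖M ω‖ := by
  have h1 : Measurable fun s : Σ ℓ : ℕ, Sketch ℓ n => ‖s.2‖ :=
    measurable_of_comp_sigmaMk fun _ => measurable_norm
  have h2 := h1.comp hM
  simp only [Function.comp_def] at h2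
  exact h2

theorem measurableSet_trueEvent {F : Euc n → Euc m} (hF : Continuous (∇ (objective F)))
    (ε Mmax : ℝ) {X : ℕ → Ω → Euc n} {L : ℕ → Ω → ℕ} {M : (k : ℕ) → (ω : Ω) → Sketch (L k ω) n}
    {k : ℕ} (hX : Measurable (X k))
    (hM : Measurable fun ω => (⟨L k ω, M k ω⟩ : Σ ℓ : ℕ, Sketch ℓ n)) :
    MeasurableSet (trueEvent F ε Mmax X L M k) := by
  have hg := hF.measurable.comp hX
  exact (measurableSet_le ((hg.norm.pow_const 2).const_mul _)
    ((measurable_norm_sketch_apply hM hg).pow_const 2)).inter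
    (measurableSet_le (measurable_norm_sketch hM) measurable_const)

end Measurability

theorem hittingTime_le_of_norm_le {Ω : Type*} {n m : ℕ} {F : Euc n → Euc m} {τ : ℝ}
    {X : ℕ → Ω → Euc n} {ω : Ω} {k : ℕ} (h : ‖∇ (objective F) (X k ω)‖ ≤ τ) :
    hittingTime F τ X ω ≤ k :=
  iInf_le (fun k : {k : ℕ // ‖∇ (objective F) (X k ω)‖ ≤ τ} => ((k : ℕ) : ℕ∞)) ⟨k, h⟩

end SketchedLM

end

/-! ### The complexity bound -/

theorem theorem3p10 {Ω : Type*} [MeasurableSpace Ω] (Pr : MeasureTheory.Measure Ω)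
    [MeasureTheory.IsProbabilityMeasure Pr]
    {n m : ℕ} (F : SketchedLM.Euc n → SketchedLM.Euc m) (hF : ContDiff ℝ 1 F)
    -- the objective is bounded below by `fstar` and its gradient is `Lip`-Lipschitz
    (fstar : ℝ) (hfstar : ∀ x, fstar ≤ SketchedLM.objective F x)
    (Lip : ℝ) (hLip : 0 < Lip)
    (hgrad : ∀ x y, ‖gradient (SketchedLM.objective F) x - gradient (SketchedLM.objective F) y‖
      ≤ Lip * ‖x - y‖)
    -- parameters and deterministic initial data of the algorithm
    (P : SketchedLM.Params n) (x₀ : SketchedLM.Euc n) (t₀ : ℝ) (ht₀ : t₀ ∈ Set.Ioc 0 P.tmax)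
    (ℓ₀ : ℕ) (hℓ₀ : ℓ₀ ∈ Set.Icc P.ℓmin P.ℓmax)
    -- the random iterates, steplengths, sketching sizes, sketching matrices, forcing terms,
    -- regularization parameters and reduced steps
    (X : ℕ → Ω → SketchedLM.Euc n) (t : ℕ → Ω → ℝ) (L : ℕ → Ω → ℕ)
    (M : (k : ℕ) → (ω : Ω) → SketchedLM.Sketch (L k ω) n)
    (η μ : ℕ → Ω → ℝ) (v : (k : ℕ) → (ω : Ω) → SketchedLM.Euc (L k ω))
    (hX : ∀ k, Measurable (X k)) (hL : ∀ k, Measurable (L k))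
    (hM : ∀ k, Measurable fun ω => (⟨L k ω, M k ω⟩ : Σ ℓ : ℕ, SketchedLM.Sketch ℓ n))
    (hrun : ∀ᵐ ω ∂Pr, SketchedLM.IsRealization P F x₀ t₀ ℓ₀ (fun k => X k ω) (fun k => t k ω)
      (fun k => L k ω) (fun k => M k ω) (fun k => η k ω) (fun k => μ k ω) (fun k => v k ω))
    -- the constants in the definition of a true iteration
    (ε : ℝ) (hε : ε ∈ Set.Ioo (0 : ℝ) 1) (Mmax : ℝ) (hMmax : 0 < Mmax)
    -- the sketched Hessians are uniformly bounded at true iterations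
    (σ : ℝ) (hσ : 0 < σ)
    (hbound : ∀ᵐ ω ∂Pr, ∀ k, ω ∈ SketchedLM.trueEvent F ε Mmax X L M k →
      SketchedLM.maxSingularValue (SketchedLM.sketchedHess F (X k ω) (M k ω)) ≤ σ)
    -- iterations are true in probability
    (δM : ℝ) (hδM : δM ∈ Set.Ioo (0 : ℝ) (1 / 4))
    (htrue : SketchedLM.TrueInProbability Pr F ε Mmax δM X L M)
    (τ : ℝ) (hτ : 0 < τ)
    (δ₁ : ℝ) (hδ₁ : δ₁ ∈ Set.Ioo (0 : ℝ) 1) (hδ : 0 < (1 - δM) * (1 - δ₁) - 3 / 4)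
    (N : ℕ)
    (hN : ((1 - δM) * (1 - δ₁) - 3 / 4)⁻¹ *
        ((SketchedLM.objective F x₀ - fstar) /
            SketchedLM.hFun P ε σ τ (t₀ * P.γ ^ (1 + SketchedLM.psi P Lip Mmax t₀))
          + (SketchedLM.psi P Lip Mmax t₀ : ℝ) / 2) ≤ (N : ℝ)) :
    1 - Real.exp (-(δ₁ ^ 2 / 2) * (1 - δM) * N) ≤
      Pr.real {ω | SketchedLM.hittingTime F τ X ω ≤ (N : ℕ∞)} := by
  classical
  have hFd : Differentiable ℝ F := hF.differentiable one_ne_zero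
  have hcont : Continuous (gradient (SketchedLM.objective F)) :=
    (LipschitzWith.of_dist_le_mul (K := ⟨Lip, hLip.le⟩) fun x y => by
      rw [dist_eq_norm, dist_eq_norm]; exact hgrad x y).continuous
  set T := SketchedLM.trueEvent F ε Mmax X L M with hTdef
  have hT : ∀ k, MeasurableSet (T k) := fun k =>
    SketchedLM.measurableSet_trueEvent hcont ε Mmax (hX k) (hM k)
  have hp : 0 ≤ 1 - δM := by linarith [hδM.2]
  have hpast : ∀ k A, MeasurableSet[SketchedLM.sigmaPast T k] A →
      (1 - δM) * Pr.real A ≤ Pr.real (T k ∩ A) := by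
    intro k A hA
    refine SketchedLM.mul_measureReal_le_of_condIndepEvent ((hX k).prodMk (hL k)).comap_le
      (MeasurableSpace.generateFrom_le ?_) (hT k) (htrue k).1 (htrue k).2 hA
    rintro _ ⟨i, _, rfl⟩
    exact hT i
  have hchernoff := SketchedLM.measureReal_countTrue_le hT hp hpast hδ₁.1.le N
  set C : Set Ω := {ω | (SketchedLM.countTrue T N ω : ℝ) ≤ (1 - δM) * (1 - δ₁) * N}
  have hC : MeasurableSet C := measurableSet_le
    (measurable_from_nat.comp (SketchedLM.measurable_countTrue fun i _ => hT i)) measurable_const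
  -- outside `C` there are too many true iterations for all gradients to exceed `τ`
  have hsub : Cᶜ ≤ᵐ[Pr] {ω | SketchedLM.hittingTime F τ X ω ≤ (N : ℕ∞)} := by
    filter_upwards [hrun, hbound] with ω hω hbω hCω
    by_contra hhit
    have hbig : ∀ k < N, τ ≤ ‖gradient (SketchedLM.objective F) (X k ω)‖ := by
      intro k hk
      by_contra! hlt
      exact hhit ((SketchedLM.hittingTime_le_of_norm_le hlt.le).trans (by exact_mod_cast hk.le))
    have hcount := hω.count_true_le hFd hfstar hLip hgrad ht₀ hε.2 hMmax hσ hbω hτ hbig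
    have hmany : (1 - δM) * (1 - δ₁) * N < (SketchedLM.countTrue T N ω : ℝ) := not_le.1 hCω
    have heq : SketchedLM.countTrue T N ω =
        Nat.count (fun k => SketchedLM.IsTrueIteration F ε Mmax (X k ω) (M k ω)) N := rfl
    rw [heq] at hmany
    rw [inv_mul_le_iff₀ hδ] at hN
    have hN0 : (0 : ℝ) ≤ N := N.cast_nonneg
    linarith
  have hle : Pr.real Cᶜ ≤ Pr.real {ω | SketchedLM.hittingTime F τ X ω ≤ (N : ℕ∞)} :=
    ENNReal.toReal_mono (measure_ne_top _ _) (measure_mono_ae hsub)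
  rw [probReal_compl_eq_one_sub hC] at hle
  linarith
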